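/- A quantum query algorithm for inputs $x:I\to\{0,\dots,q-1\}$ applies unitaries that do not depend on $x$, interleaved with applications of the oracle $|i,b,w\rangle\mapsto|i,\,b+x(i)\bmod q,\,w\rangle$ (where the algorithm may also leave a query unused), and finally measures; it decides a problem if on every admissible input it answers correctly with probability at least $2/3$. The quantum query complexity of a problem is the least number of oracle applications of an algorithm deciding it. In the adjacency-matrix model, a graph on the vertices $v_0,\dots,v_{n-1}$, $n\ge 1$, is given by its matrix $M\in\{0,1\}^{n\times n}$, $M_{ij}=1$ iff $(v_i,v_j)$ is an edge; for undirected graphs $M$ is promised to be symmetric. In the adjacency-list model, a graph in which every vertex has out-degree $k$ is given by $f:[n]\times[k]\to[n]$, where $f(u,0),\dots,f(u,k-1)$ are the neighbours of $u$, promised to be distinct; for undirected graphs it is also promised that $v$ occurs among the neighbours of $u$ only if $u$ occurs among those of $v$. **Theorem.** The quantum query complexity of Connectivity, that is, of deciding whether an undirected graph is connected, is $O(n^{3/2}\log n)$ in the adjacency-matrix model and $O(n\sqrt k\log n)$ in the adjacency-list model. For directed graphs, the same bounds hold for deciding whether all vertices can be reached from a given vertex $v_0$. The implied constants are absolute: the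 bounds hold for all $n\ge1$ and all $k$. -/

import Mathlib

namespace QuantumQuery

/-- A (possibly promise) decision problem about a string `x` of letters in `{0, …, q-1}` indexed by
`ι`: the strings that may occur as inputs, and those among them whose answer is yes. -/
structure Problem (ι : Type) (q : ℕ) where
  Valid : (ι → Fin q) → Prop
  Yes : (ι → Fin q) → Prop

/-- The query of the input `x` as an operator on amplitudes: it is the linear map that sends the
basis state `|i, b, w⟩` to `|i, b + x i mod q, w⟩` for an index `i` and fixes `|none, b, w⟩`, where
the value `none` of the index register stands for not asking for any letter. -/
def oracle {ι W : Type} {q : ℕ} (x : ι → Fin q)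
    (ψ : Option ι × Fin q × W → ℂ) : Option ι × Fin q × W → ℂ
  | (some i, b, w) => ψ (some i, b - x i, w)
  | (none, b, w) => ψ (none, b, w)

/-- A quantum query algorithm: an index register, an answer register and a finite workspace `W`; it
starts in a basis state, applies unitaries that do not depend on the input, makes `queries` queries
in between, and measures in the computational basis at the end. Only the unitaries
`U 0, …, U queries` are used. -/
structure Algorithm (ι : Type) [Fintype ι] [DecidableEq ι] (q : ℕ) where
  W : Type
  [fintypeW : Fintype W]
  [decidableEqW : DecidableEq W]
  start : Option ι × Fin q × W
  queries : ℕ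
  U : ℕ → Matrix.unitaryGroup (Option ι × Fin q × W) ℂ
  accept : Finset (Option ι × Fin q × W)

attribute [instance] Algorithm.fintypeW Algorithm.decidableEqW

variable {ι : Type} [Fintype ι] [DecidableEq ι] {q : ℕ}

/-- The state `U t · O · U (t-1) ⋯ O · U 0 |start⟩` on input `x` after `t` queries. -/
noncomputable def Algorithm.state (A : Algorithm ι q) (x : ι → Fin q) :
    ℕ → (Option ι × Fin q × A.W → ℂ)
  | 0 => Matrix.mulVec (A.U 0 : Matrix _ _ ℂ) (Pi.single A.start 1)
  | t + 1 => Matrix.mulVec (A.U (t + 1) : Matrix _ _ ℂ) (oracle x (A.state x t))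

/-- The probability that the final measurement gives an accepting outcome. -/
noncomputable def Algorithm.acceptProb (A : Algorithm ι q) (x : ι → Fin q) : ℝ :=
  ∑ a ∈ A.accept, ‖A.state x A.queries a‖ ^ 2

/-- The algorithm decides the problem with two-sided error at most `1/3` on every valid input. -/
def Algorithm.Decides (A : Algorithm ι q) (P : Problem ι q) : Prop :=
  ∀ x, P.Valid x →
    (P.Yes x → 2 / 3 ≤ A.acceptProb x) ∧ (¬ P.Yes x → A.acceptProb x ≤ 1 / 3)

/-- The bounded-error quantum query complexity: the least number of queries of an algorithm that
decides the problem, and `⊤` if there is none. -/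
noncomputable def complexity (P : Problem ι q) : ℕ∞ :=
  ⨅ (A : Algorithm ι q) (_ : A.Decides P), (A.queries : ℕ∞)

/-- The edge relation of the directed graph with adjacency matrix `M`. -/
def matrixEdge {n : ℕ} (M : Fin n × Fin n → Fin 2) (u v : Fin n) : Prop :=
  M (u, v) = 1

/-- The edge relation of the directed graph given by lists, `f (u, i)` being the `i`-th
out-neighbour of `u`. -/
def listEdge {n k : ℕ} (f : Fin n × Fin k → Fin n) (u v : Fin n) : Prop :=
  ∃ i, f (u, i) = v

/-- The promise that no out-neighbour is listed twice: every out-degree is then `k`. -/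
def SimpleLists {n k : ℕ} (f : Fin n × Fin k → Fin n) : Prop :=
  ∀ u i j, i ≠ j → f (u, i) ≠ f (u, j)

/-- Connectivity of undirected graphs in the adjacency matrix model. The edge relation of a valid
input is symmetric; `SimpleGraph.fromRel` drops loops, which do not matter for connectivity. -/
def matrixConnectivity (n : ℕ) : Problem (Fin n × Fin n) 2 where
  Valid M := ∀ u v, M (u, v) = M (v, u)
  Yes M := (SimpleGraph.fromRel (matrixEdge M)).Connected

/-- Connectivity of undirected graphs in the adjacency list model. -/
def listConnectivity (n k : ℕ) : Problem (Fin n × Fin k) n where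
  Valid f := SimpleLists f ∧ ∀ u v, listEdge f u v → listEdge f v u
  Yes f := (SimpleGraph.fromRel (listEdge f)).Connected

/-- Whether every vertex of a directed graph can be reached from `s`, in the matrix model. -/
def matrixReachability (n : ℕ) (s : Fin n) : Problem (Fin n × Fin n) 2 where
  Valid _ := True
  Yes M := ∀ v, Relation.ReflTransGen (matrixEdge M) s v

/-- Whether every vertex of a directed graph can be reached from `s`, in the list model. -/
def listReachability (n k : ℕ) (s : Fin n) : Problem (Fin n × Fin k) n where
  Valid f := SimpleLists f
  Yes f := ∀ v, Relation.ReflTransGen (listEdge f) s v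

end QuantumQuery

/-! A classical search of a graph with `n` vertices and `k` ports at each vertex (`k = n` for
matrices) asks `n * k` questions, of which at most `n` reveal a new vertex. If every answer is
guessed to reveal nothing, at most `n` guesses are wrong, and this brings the quantum cost down to
the order of `√(n * k * n) = n * √k`. The logarithm is thus only slack, except at `n = 1`, where it
vanishes and no query may be made.

The gain comes from the dual adversary bound (`exists_algorithm_of_guessing`). The transcripts of a
yes input and a no input diverge exactly once, at a question where their letters differ. Vectors
supported on the transcripts, whose pairing is `0` on equal digests and `1` on different ones,
therefore satisfy the constraints. Right guesses cost `ρ⁻¹` and wrong ones `ρ + 2`, so the squared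
norms are at most `T / ρ + G * (ρ + 2)`; `ρ = √k` balances the two terms.

`exists_algorithm_of_dual_adversary` turns such vectors into an algorithm. A uniform superposition
of `N` flagged times is accompanied by a catalyst, the vector of the input. Round `t` sets the flag
at time `t` on yes inputs, leaves all flags alone on no inputs, and otherwise only changes the sign
of the catalyst. The catalyst is short compared with `√N`, so that starting without it causes only a
small error. -/

namespace QuantumQuery

/-! ### Unitaries and reflections -/

section Unitary

variable {X : Type*} [Fintype X] [DecidableEq X]

/-- The matrix of a linear isometry in the computational basis. -/
noncomputable def unitaryOf (e : EuclideanSpace ℂ X ≃ₗᵢ[ℂ] EuclideanSpace ℂ X) :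
    Matrix.unitaryGroup X ℂ :=
  ⟨(EuclideanSpace.basisFun X ℂ).toBasis.toMatrix ((EuclideanSpace.basisFun X ℂ).map e),
    OrthonormalBasis.toMatrix_orthonormalBasis_mem_unitary _ _⟩

lemma unitaryOf_mulVec (e : EuclideanSpace ℂ X ≃ₗᵢ[ℂ] EuclideanSpace ℂ X)
    (ψ : EuclideanSpace ℂ X) :
    Matrix.mulVec (unitaryOf e : Matrix X X ℂ) ψ.ofLp = (e ψ).ofLp := by
  have h : e ψ = ∑ j, ψ j • e (EuclideanSpace.single j 1) := by
    conv_lhs => rw [← (EuclideanSpace.basisFun X ℂ).sum_repr ψ]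
    simp
  funext i
  rw [h, WithLp.ofLp_sum, Finset.sum_apply]
  simp [unitaryOf, Matrix.mulVec, dotProduct, Module.Basis.toMatrix_apply, mul_comm]

variable {E : Type*} [NormedAddCommGroup E] [InnerProductSpace ℂ E] [FiniteDimensional ℂ E]

/-- The unitary that changes the sign of the vectors of `S` and fixes everything orthogonal to
them. -/
noncomputable def flip (S : Set E) : E ≃ₗᵢ[ℂ] E := (Submodule.span ℂ S)ᗮ.reflection

lemma flip_add {S : Set E} {a b : E} (ha : ∀ s ∈ S, inner ℂ s a = 0)
    (hb : b ∈ Submodule.span ℂ S) : flip S (a + b) = a - b := by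
  have ha' : a ∈ (Submodule.span ℂ S)ᗮ := by
    rw [Submodule.mem_orthogonal]
    intro s hs
    induction hs using Submodule.span_induction with
    | mem s hs => exact ha s hs
    | zero => simp
    | add s t _ _ h₁ h₂ => rw [inner_add_left, h₁, h₂, add_zero]
    | smul c s _ h => rw [inner_smul_left, h, mul_zero]
  have hb' : b ∈ (Submodule.span ℂ S)ᗮᗮ := Submodule.le_orthogonal_orthogonal _ hb
  rw [flip, map_add, Submodule.reflection_mem_subspace_eq_self ha',
    Submodule.reflection_mem_subspace_orthogonalComplement_eq_neg hb', sub_eq_add_neg]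

lemma flip_of_orthogonal {S : Set E} {a : E} (ha : ∀ s ∈ S, inner ℂ s a = 0) :
    flip S a = a := by
  simpa using flip_add ha (Submodule.zero_mem (Submodule.span ℂ S))

/-- The two hypotheses make `v + w` orthogonal to `v - w`, so negating `v - w` swaps `v` and `w`. -/
lemma exists_isometry_map {v w : E} (hn : ‖v‖ = ‖w‖) (hi : inner ℂ v w = inner ℂ w v) :
    ∃ e : E ≃ₗᵢ[ℂ] E, e v = w := by
  refine ⟨flip {v - w}, ?_⟩
  have h := flip_add (S := {v - w}) (a := (1 / 2 : ℂ) • (v + w)) (b := (1 / 2 : ℂ) • (v - w))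
    (by
      rintro s rfl
      rw [inner_smul_right, inner_sub_left, inner_add_right, inner_add_right,
        inner_self_eq_norm_sq_to_K, inner_self_eq_norm_sq_to_K, hn, hi]
      ring)
    (Submodule.smul_mem _ _ (Submodule.mem_span_singleton_self _))
  rw [← smul_add, ← smul_sub] at h
  convert h using 2 <;> module

end Unitary

/-! ### The query as a permutation of basis states -/

section Oracle

variable {ι W : Type} {q : ℕ} [NeZero q]

/-- The permutation of the basis states performed by a query. -/
def oraclePerm (W : Type) (x : ι → Fin q) :
    Option ι × Fin q × W ≃ Option ι × Fin q × W where
  toFun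
    | (some i, b, w) => (some i, b + x i, w)
    | (none, b, w) => (none, b, w)
  invFun
    | (some i, b, w) => (some i, b - x i, w)
    | (none, b, w) => (none, b, w)
  left_inv := by rintro ⟨_ | i, b, w⟩ <;> simp
  right_inv := by rintro ⟨_ | i, b, w⟩ <;> simp

/-- The permutation of the basis states that negates the answer register. -/
def negPerm (ι W : Type) (q : ℕ) [NeZero q] :
    Option ι × Fin q × W ≃ Option ι × Fin q × W :=
  (Equiv.refl _).prodCongr ((Equiv.neg _).prodCongr (Equiv.refl _))

variable [Fintype ι] [Fintype W]

noncomputable def oracleIso (W : Type) [Fintype W] (x : ι → Fin q) :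
    EuclideanSpace ℂ (Option ι × Fin q × W) ≃ₗᵢ[ℂ] EuclideanSpace ℂ (Option ι × Fin q × W) :=
  LinearIsometryEquiv.piLpCongrLeft 2 ℂ ℂ (oraclePerm W x)

noncomputable def negIso (ι W : Type) (q : ℕ) [NeZero q] [Fintype ι] [Fintype W] :
    EuclideanSpace ℂ (Option ι × Fin q × W) ≃ₗᵢ[ℂ] EuclideanSpace ℂ (Option ι × Fin q × W) :=
  LinearIsometryEquiv.piLpCongrLeft 2 ℂ ℂ (negPerm ι W q)

lemma oracle_ofLp (x : ι → Fin q) (ψ : EuclideanSpace ℂ (Option ι × Fin q × W)) :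
    oracle x ψ.ofLp = (oracleIso W x ψ).ofLp := by
  funext ⟨i, b, w⟩
  cases i <;> rfl

/-- Subtracting a letter is adding it between two negations of the answer register. Hence undoing a
query costs one query, the negations being absorbed into the unitaries around it. -/
lemma negIso_oracleIso_negIso (x : ι → Fin q) (ψ : EuclideanSpace ℂ (Option ι × Fin q × W)) :
    negIso ι W q (oracleIso W x (negIso ι W q ψ)) = (oracleIso W x).symm ψ := by
  ext ⟨i, b, w⟩
  rw [oracleIso, LinearIsometryEquiv.piLpCongrLeft_symm]
  change ψ ((negPerm ι W q).symm ((oraclePerm W x).symm ((negPerm ι W q).symm (i, b, w)))) =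
    ψ (oraclePerm W x (i, b, w))
  have h : (negPerm ι W q).symm ((oraclePerm W x).symm ((negPerm ι W q).symm (i, b, w))) =
      oraclePerm W x (i, b, w) := by
    cases i <;> simp [negPerm, oraclePerm, Equiv.prodCongr, add_comm]
  rw [h]

lemma oracleIso_single [DecidableEq ι] [DecidableEq W] (x : ι → Fin q)
    (a : Option ι × Fin q × W) (c : ℂ) :
    oracleIso W x (EuclideanSpace.single a c) = EuclideanSpace.single (oraclePerm W x a) c :=
  LinearIsometryEquiv.piLpCongrLeft_single _ _ _

end Oracle

/-! ### One round with a catalyst -/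

section Adversary

open scoped ComplexConjugate

variable {ι L : Type} [Fintype ι] [DecidableEq ι] [Fintype L] [DecidableEq L] {q : ℕ} [NeZero q]
  {N : ℕ}

/-- The computational basis of the algorithm: a clock with a flag, or a label `l`. -/
abbrev Basis (ι L : Type) (q N : ℕ) : Type := Option ι × Fin q × ((Fin N × Bool) ⊕ L)

/-- The superposition of the times `j`, flagged by `b j`. -/
noncomputable def clock (ι L : Type) [Fintype ι] [DecidableEq ι] [Fintype L] [DecidableEq L]
    (q : ℕ) [NeZero q] (b : Fin N → Bool) : EuclideanSpace ℂ (Basis ι L q N) :=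
  ∑ j, EuclideanSpace.single (none, 0, Sum.inl (j, b j)) 1

/-- The vector with amplitude `f l` at label `l`, next to the index `J l` and the letter `c l`. -/
noncomputable def labelled (N : ℕ) (J : L → ι) (c : L → Fin q) (f : L → ℂ) :
    EuclideanSpace ℂ (Basis ι L q N) :=
  ∑ l, f l • EuclideanSpace.single (some (J l), c l, Sum.inr l) 1

/-- The difference of the two flags at time `j`. -/
noncomputable def flagDiff (ι L : Type) [Fintype ι] [DecidableEq ι] [Fintype L] [DecidableEq L]
    (q : ℕ) [NeZero q] (j : Fin N) : EuclideanSpace ℂ (Basis ι L q N) :=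
  EuclideanSpace.single (none, 0, Sum.inl (j, false)) 1 -
    EuclideanSpace.single (none, 0, Sum.inl (j, true)) 1

lemma clock_apply (b : Fin N → Bool) (a : Basis ι L q N) :
    clock ι L q b a = if ∃ j, a = (none, 0, Sum.inl (j, b j)) then 1 else 0 := by
  rw [clock, WithLp.ofLp_sum, Finset.sum_apply]
  split_ifs with h
  · obtain ⟨j, rfl⟩ := h
    rw [Finset.sum_eq_single j]
    · simp
    · intro i _ hi
      simp [Ne.symm hi]
    · simp
  · refine Finset.sum_eq_zero fun j _ => ?_
    rw [PiLp.single_apply, if_neg fun h' => h ⟨j, h'⟩]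

omit [Fintype ι] [NeZero q] in
lemma labelled_apply_inl (J : L → ι) (c : L → Fin q) (f : L → ℂ) (i : Option ι) (d : Fin q)
    (p : Fin N × Bool) : labelled N J c f (i, d, Sum.inl p) = 0 := by
  simp [labelled]

omit [Fintype ι] [NeZero q] in
lemma labelled_apply_label (J : L → ι) (c : L → Fin q) (f : L → ℂ) (d : Fin q) (l : L) :
    labelled N J c f (some (J l), d, Sum.inr l) = if d = c l then f l else 0 := by
  rw [labelled, WithLp.ofLp_sum, Finset.sum_apply, Finset.sum_eq_single l]
  · simp
  · intro m _ hm
    simp [Ne.symm hm]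
  · simp

omit [NeZero q] in
lemma inner_labelled (J : L → ι) (c d : L → Fin q) (f g : L → ℂ) :
    inner ℂ (labelled N J c f) (labelled N J d g) =
      ∑ l, if c l = d l then conj (f l) * g l else 0 := by
  rw [labelled, sum_inner]
  refine Finset.sum_congr rfl fun l _ => ?_
  rw [inner_smul_left, EuclideanSpace.inner_single_left, labelled_apply_label]
  split_ifs <;> simp

lemma inner_labelled_clock (J : L → ι) (c : L → Fin q) (f : L → ℂ) (b : Fin N → Bool) :
    inner ℂ (labelled N J c f) (clock ι L q b) = 0 := by
  rw [labelled, sum_inner]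
  refine Finset.sum_eq_zero fun l _ => ?_
  rw [inner_smul_left, EuclideanSpace.inner_single_left, clock_apply]
  simp

lemma inner_flagDiff_labelled (J : L → ι) (c : L → Fin q) (f : L → ℂ) (j : Fin N) :
    inner ℂ (flagDiff ι L q j) (labelled N J c f) = 0 := by
  rw [flagDiff, inner_sub_left, EuclideanSpace.inner_single_left, EuclideanSpace.inner_single_left,
    labelled_apply_inl, labelled_apply_inl]
  simp

lemma inner_labelled_flagDiff (J : L → ι) (c : L → Fin q) (f : L → ℂ) (j : Fin N) :
    inner ℂ (labelled N J c f) (flagDiff ι L q j) = 0 := by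
  rw [← inner_conj_symm, inner_flagDiff_labelled, map_zero]

lemma inner_flagDiff_clock (b : Fin N → Bool) (j : Fin N) (hb : b j = false) :
    inner ℂ (flagDiff ι L q j) (clock ι L q b) = 1 := by
  rw [flagDiff, inner_sub_left, EuclideanSpace.inner_single_left, EuclideanSpace.inner_single_left,
    clock_apply, clock_apply, if_pos ⟨j, by rw [hb]⟩, if_neg]
  · simp
  · rintro ⟨i, hi⟩
    simp only [Prod.mk.injEq, Sum.inl.injEq, true_and] at hi
    obtain ⟨rfl, hi⟩ := hi
    simp [hb] at hi

lemma inner_flagDiff_self (j : Fin N) :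
    inner ℂ (flagDiff ι L q j) (flagDiff ι L q j) = 2 := by
  conv_lhs => arg 2; rw [flagDiff]
  rw [inner_sub_left, EuclideanSpace.inner_single_left, EuclideanSpace.inner_single_left]
  simp only [flagDiff, WithLp.ofLp_sub, Pi.sub_apply, PiLp.single_apply]
  simp
  norm_num

lemma norm_clock_sq (b : Fin N → Bool) : ‖clock ι L q b‖ ^ 2 = N := by
  have h : inner ℂ (clock ι L q b) (clock ι L q b) = (N : ℂ) := by
    conv_lhs => arg 2; rw [clock]
    rw [sum_inner]
    calc _ = ∑ _j : Fin N, (1 : ℂ) := Finset.sum_congr rfl fun j _ => by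
            rw [EuclideanSpace.inner_single_left, clock_apply, if_pos ⟨j, rfl⟩]
            simp
      _ = N := by simp
  rw [inner_self_eq_norm_sq_to_K] at h
  exact Complex.ofReal_injective (by push_cast; exact h)

omit [NeZero q] in
lemma norm_labelled_sq (J : L → ι) (c : L → Fin q) (f : L → ℂ) :
    ‖labelled N J c f‖ ^ 2 = ∑ l, ‖f l‖ ^ 2 := by
  have h := inner_labelled (N := N) J c c f f
  rw [inner_self_eq_norm_sq_to_K] at h
  simp only [if_true, Complex.conj_mul'] at h
  exact Complex.ofReal_injective (by push_cast; exact h)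

lemma oracleIso_clock (x : ι → Fin q) (b : Fin N → Bool) :
    oracleIso _ x (clock ι L q b) = clock ι L q b := by
  simp [clock, oracleIso_single, oraclePerm]

lemma oracleIso_labelled (x : ι → Fin q) (J : L → ι) (f : L → ℂ) :
    oracleIso _ x (labelled N J 0 f) = labelled N J (fun l => x (J l)) f := by
  simp [labelled, oracleIso_single, oraclePerm]

lemma clock_step (t : ℕ) (ht : t < N) :
    clock ι L q (fun j : Fin N => decide ((j : ℕ) < t)) - flagDiff ι L q ⟨t, ht⟩ =
      clock ι L q (fun j : Fin N => decide ((j : ℕ) < t + 1)) := by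
  rw [sub_eq_iff_eq_add, clock, clock, ← sub_eq_iff_eq_add', ← Finset.sum_sub_distrib,
    Finset.sum_eq_single ⟨t, ht⟩]
  · simp [flagDiff]
  · intro j _ hj
    have : (j : ℕ) ≠ t := fun h => hj (Fin.ext h)
    have h : decide ((j : ℕ) < t) = decide ((j : ℕ) < t + 1) := by
      rw [decide_eq_decide]
      omega
    rw [h, sub_self]
  · simp

/-- The vectors reflected at time `t`, before the queries. -/
def startVectors (N : ℕ) (J : L → ι) (Y : (ι → Fin q) → Prop) (u : (ι → Fin q) → L → ℂ) (t : ℕ) :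
    Set (EuclideanSpace ℂ (Basis ι L q N)) :=
  {z | ∃ ht : t < N, ∃ x, Y x ∧
    z = flagDiff ι L q ⟨t, ht⟩ + (2 * (-1) ^ t : ℂ) • labelled N J 0 (u x)}

/-- The vectors reflected between a query and its inverse. -/
def queryVectors (N : ℕ) (J : L → ι) (Z : (ι → Fin q) → Prop) (w : (ι → Fin q) → L → ℂ) :
    Set (EuclideanSpace ℂ (Basis ι L q N)) :=
  {z | ∃ y, Z y ∧ z = labelled N J (fun l => y (J l)) (w y)}

section Steps

variable {J : L → ι} {Y Z : (ι → Fin q) → Prop} {u w : (ι → Fin q) → L → ℂ}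

/-- The state contains half of a reflected vector; what remains, `clock - flagDiff / 2`, is
orthogonal to all of them because `1 - 2 / 2 = 0`. Negating that half sets the flag at time `t` and
changes the sign of the catalyst. -/
lemma flip_startVectors_yes {x : ι → Fin q} (hx : Y x)
    {t : ℕ} (ht : t < N) :
    flip (startVectors N J Y u t)
        (clock ι L q (fun j : Fin N => decide ((j : ℕ) < t)) +
          (-1 : ℂ) ^ t • labelled N J 0 (u x)) =
      clock ι L q (fun j : Fin N => decide ((j : ℕ) < t + 1)) -
        (-1 : ℂ) ^ t • labelled N J 0 (u x) := by
  have h := flip_add (S := startVectors N J Y u t)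
    (a := clock ι L q (fun j : Fin N => decide ((j : ℕ) < t)) -
      (1 / 2 : ℂ) • flagDiff ι L q ⟨t, ht⟩)
    (b := (1 / 2 : ℂ) • (flagDiff ι L q ⟨t, ht⟩ + (2 * (-1) ^ t : ℂ) • labelled N J 0 (u x)))
    (by
      rintro _ ⟨_, x', _, rfl⟩
      rw [inner_add_left, inner_sub_right, inner_sub_right, inner_smul_left, inner_smul_right,
        inner_flagDiff_clock _ _ (by simp), inner_flagDiff_self, inner_labelled_clock,
        inner_smul_left, inner_smul_right, inner_labelled_flagDiff]
      norm_num)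
    (Submodule.smul_mem _ _ (Submodule.subset_span ⟨ht, x, hx, rfl⟩))
  rw [← clock_step t ht]
  refine (congrArg _ ?_).trans (h.trans ?_) <;> module

/-- The overlap with a reflected vector is `1 + 2 * (-1 / 2) = 0`, since the two signs `(-1) ^ t`
cancel. This dictates the constant `-1 / 2`. -/
lemma flip_startVectors_no {f : L → ℂ}
    (huw : ∀ x, Y x → ∑ l, conj (u x l) * f l = -1 / 2) (t : ℕ) :
    flip (startVectors N J Y u t)
        (clock ι L q (fun _ : Fin N => false) + (-1 : ℂ) ^ t • labelled N J 0 f) =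
      clock ι L q (fun _ : Fin N => false) + (-1 : ℂ) ^ t • labelled N J 0 f := by
  refine flip_of_orthogonal ?_
  rintro _ ⟨ht, x, hx, rfl⟩
  rw [inner_add_left, inner_add_right, inner_add_right, inner_smul_left, inner_smul_right,
    inner_smul_right, inner_smul_left, inner_flagDiff_clock _ _ rfl, inner_flagDiff_labelled,
    inner_labelled_clock, inner_labelled]
  simp only [Pi.zero_apply, if_true, huw x hx]
  rcases neg_one_pow_eq_or ℂ t with h | h <;> rw [h] <;> norm_num [map_ofNat]

/-- One round of the algorithm: reflect, query, reflect, undo the query. -/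
noncomputable def round (J : L → ι) (Y Z : (ι → Fin q) → Prop) (u w : (ι → Fin q) → L → ℂ)
    (x : ι → Fin q) (t : ℕ) (ψ : EuclideanSpace ℂ (Basis ι L q N)) :
    EuclideanSpace ℂ (Basis ι L q N) :=
  (oracleIso _ x).symm (flip (queryVectors N J Z w)
    (oracleIso _ x (flip (startVectors N J Y u t) ψ)))

/-- Once queried, the catalyst carries the letters of `x` and is orthogonal by `h0` to everything
reflected between the queries, so only the first reflection acts. -/
lemma round_yes (h0 : ∀ x y, Y x → Z y →
      ∑ l, (if x (J l) = y (J l) then conj (u x l) * w y l else 0) = 0)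
    {x : ι → Fin q} (hx : Y x) {t : ℕ} (ht : t < N) :
    round J Y Z u w x t (clock ι L q (fun j : Fin N => decide ((j : ℕ) < t)) +
          (-1 : ℂ) ^ t • labelled N J 0 (u x)) =
      clock ι L q (fun j : Fin N => decide ((j : ℕ) < t + 1)) +
        (-1 : ℂ) ^ (t + 1) • labelled N J 0 (u x) := by
  rw [round, flip_startVectors_yes hx ht, LinearIsometryEquiv.symm_apply_eq, map_sub, map_add,
    map_smul, map_smul, oracleIso_clock, oracleIso_labelled, flip_of_orthogonal]
  · rw [pow_succ]
    module
  · rintro _ ⟨y, hy, rfl⟩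
    rw [inner_sub_right, inner_labelled_clock, inner_smul_right, ← inner_conj_symm, inner_labelled,
      h0 x y hx hy]
    simp

/-- Here only the second reflection acts: the queried catalyst is itself one of the reflected
vectors and is negated. -/
lemma round_no (huw : ∀ x y, Y x → Z y → ∑ l, conj (u x l) * w y l = -1 / 2)
    {y : ι → Fin q} (hy : Z y) (t : ℕ) :
    round J Y Z u w y t (clock ι L q (fun _ : Fin N => false) +
          (-1 : ℂ) ^ t • labelled N J 0 (w y)) =
      clock ι L q (fun _ : Fin N => false) + (-1 : ℂ) ^ (t + 1) • labelled N J 0 (w y) := by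
  rw [round, flip_startVectors_no (fun x hx => huw x y hx hy),
    LinearIsometryEquiv.symm_apply_eq, map_add (oracleIso _ y), map_add (oracleIso _ y),
    map_smul, map_smul, oracleIso_clock, oracleIso_labelled, flip_add]
  · rw [pow_succ]
    module
  · rintro _ ⟨z, _, rfl⟩
    exact inner_labelled_clock _ _ _ _
  · exact Submodule.smul_mem _ _ (Submodule.subset_span ⟨y, hy, rfl⟩)

end Steps

end Adversary

/-! ### From the dual adversary bound to an algorithm -/

section AdversaryAlgorithm

open scoped ComplexConjugate

variable {ι L : Type} [Fintype ι] [DecidableEq ι] [Fintype L] [DecidableEq L] {q : ℕ} [NeZero q]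
  {N : ℕ}

lemma norm_round_sub (J : L → ι) (Y Z : (ι → Fin q) → Prop) (u w : (ι → Fin q) → L → ℂ)
    (x : ι → Fin q) (t : ℕ) (ψ φ : EuclideanSpace ℂ (Basis ι L q N)) :
    ‖round J Y Z u w x t ψ - round J Y Z u w x t φ‖ = ‖ψ - φ‖ := by
  simp only [round, ← map_sub, LinearIsometryEquiv.norm_map]

lemma round_smul (J : L → ι) (Y Z : (ι → Fin q) → Prop) (u w : (ι → Fin q) → L → ℂ)
    (x : ι → Fin q) (t : ℕ) (c : ℂ) (ψ : EuclideanSpace ℂ (Basis ι L q N)) :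
    round J Y Z u w x t (c • ψ) = c • round J Y Z u w x t ψ := by
  simp only [round, map_smul]

/-- The state after `t` rounds. -/
noncomputable def rounds (J : L → ι) (Y Z : (ι → Fin q) → Prop) (u w : (ι → Fin q) → L → ℂ)
    (x : ι → Fin q) (ψ : EuclideanSpace ℂ (Basis ι L q N)) : ℕ → EuclideanSpace ℂ (Basis ι L q N)
  | 0 => ψ
  | t + 1 => round J Y Z u w x t (rounds J Y Z u w x ψ t)

/-- Rounds are linear isometries, so the real run stays as far from the ideal run `g`, which has the
catalyst, as it was at the start. -/
lemma norm_rounds_sub (J : L → ι) (Y Z : (ι → Fin q) → Prop) (u w : (ι → Fin q) → L → ℂ)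
    (x : ι → Fin q) (ψ : EuclideanSpace ℂ (Basis ι L q N)) (c : ℂ)
    (g : ℕ → EuclideanSpace ℂ (Basis ι L q N))
    (hg : ∀ t < N, round J Y Z u w x t (g t) = g (t + 1)) :
    ∀ t ≤ N, ‖rounds J Y Z u w x ψ t - c • g t‖ = ‖ψ - c • g 0‖ := by
  intro t
  induction t with
  | zero => intro _; rfl
  | succ t ih =>
    intro ht
    rw [rounds, ← hg t ht, ← round_smul, norm_round_sub, ih (Nat.le_of_succ_le ht)]

/-- The basis states that are accepted: those whose flag is set. -/
def flagged (ι L : Type) [Fintype ι] [DecidableEq ι] [Fintype L] [DecidableEq L] (q N : ℕ) :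
    Finset (Basis ι L q N) :=
  Finset.univ.filter fun a => ∃ j, a.2.2 = Sum.inl (j, true)

lemma Algorithm.state_succ_eq {A : Algorithm ι q} {x : ι → Fin q} {t : ℕ}
    {e : EuclideanSpace ℂ (Option ι × Fin q × A.W) ≃ₗᵢ[ℂ]
      EuclideanSpace ℂ (Option ι × Fin q × A.W)}
    {ψ : EuclideanSpace ℂ (Option ι × Fin q × A.W)} (he : A.U (t + 1) = unitaryOf e)
    (hψ : A.state x t = ψ.ofLp) : A.state x (t + 1) = (e (oracleIso A.W x ψ)).ofLp := by
  rw [Algorithm.state, hψ, he, oracle_ofLp, unitaryOf_mulVec]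

/-- The algorithm that makes `N` rounds, after preparing its first state with `prep`. -/
noncomputable def roundsAlgorithm [NeZero N] (J : L → ι) (Y Z : (ι → Fin q) → Prop)
    (u w : (ι → Fin q) → L → ℂ)
    (prep : EuclideanSpace ℂ (Basis ι L q N) ≃ₗᵢ[ℂ] EuclideanSpace ℂ (Basis ι L q N)) :
    Algorithm ι q where
  W := (Fin N × Bool) ⊕ L
  start := (none, 0, Sum.inl (0, false))
  queries := 2 * N
  U m := unitaryOf (if m = 0 then prep.trans (flip (startVectors N J Y u 0))
    else if m % 2 = 1 then (flip (queryVectors N J Z w)).trans (negIso ι _ q)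
    else (negIso ι _ q).trans (flip (startVectors N J Y u (m / 2))))
  accept := flagged ι L q N

/-- The algorithm runs one reflection ahead: the unitary after query `2 * t` already opens round
`t`. -/
lemma roundsAlgorithm_state [NeZero N] (J : L → ι) (Y Z : (ι → Fin q) → Prop)
    (u w : (ι → Fin q) → L → ℂ)
    (prep : EuclideanSpace ℂ (Basis ι L q N) ≃ₗᵢ[ℂ] EuclideanSpace ℂ (Basis ι L q N))
    (x : ι → Fin q) (t : ℕ) :
    (roundsAlgorithm J Y Z u w prep).state x (2 * t) = (flip (startVectors N J Y u t)
      (rounds J Y Z u w x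
        (prep (EuclideanSpace.single (none, 0, Sum.inl (0, false)) 1)) t)).ofLp := by
  induction t with
  | zero =>
    exact unitaryOf_mulVec (prep.trans (flip (startVectors N J Y u 0)))
      (EuclideanSpace.single (none, 0, Sum.inl (0, false)) 1)
  | succ t ih =>
    rw [show 2 * (t + 1) = 2 * t + 1 + 1 by ring]
    have h1 : (roundsAlgorithm J Y Z u w prep).U (2 * t + 1) =
        unitaryOf ((flip (queryVectors N J Z w)).trans (negIso ι _ q)) := by
      change unitaryOf _ = _
      rw [if_neg (by omega), if_pos (by omega)]
    have h2 : (roundsAlgorithm J Y Z u w prep).U (2 * t + 1 + 1) =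
        unitaryOf ((negIso ι _ q).trans (flip (startVectors N J Y u (t + 1)))) := by
      change unitaryOf _ = _
      rw [if_neg (by omega), if_neg (by omega), show (2 * t + 1 + 1) / 2 = t + 1 by omega]
    have h3 := Algorithm.state_succ_eq h2 (Algorithm.state_succ_eq h1 ih)
    refine h3.trans (congrArg (fun ψ => (flip (startVectors N J Y u (t + 1)) ψ).ofLp) ?_)
    exact negIso_oracleIso_negIso x _

section Restrict

variable {X : Type*} [Fintype X] [DecidableEq X]

/-- The projection on the amplitudes of a set of basis states. -/
noncomputable def restrict (A : Finset X) (ψ : EuclideanSpace ℂ X) : EuclideanSpace ℂ X :=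
  WithLp.toLp 2 fun a => if a ∈ A then ψ a else 0

lemma norm_restrict_sq (A : Finset X) (ψ : EuclideanSpace ℂ X) :
    ‖restrict A ψ‖ ^ 2 = ∑ a ∈ A, ‖ψ a‖ ^ 2 := by
  rw [EuclideanSpace.norm_sq_eq, ← Finset.sum_subset (Finset.subset_univ A)]
  · exact Finset.sum_congr rfl fun a ha => by simp [restrict, ha]
  · intro a _ ha
    simp [restrict, ha]

lemma norm_restrict_sub_le (A : Finset X) (ψ φ : EuclideanSpace ℂ X) :
    ‖restrict A ψ - restrict A φ‖ ≤ ‖ψ - φ‖ := by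
  have h : restrict A ψ - restrict A φ = restrict A (ψ - φ) := by
    ext a
    simp only [restrict, WithLp.ofLp_sub, Pi.sub_apply]
    split_ifs <;> simp
  rw [h]
  refine le_of_sq_le_sq ?_ (norm_nonneg _)
  rw [norm_restrict_sq, EuclideanSpace.norm_sq_eq]
  exact Finset.sum_le_univ_sum_of_nonneg fun _ => sq_nonneg _

end Restrict

lemma exists_prep [NeZero N] :
    ∃ prep : EuclideanSpace ℂ (Basis ι L q N) ≃ₗᵢ[ℂ] EuclideanSpace ℂ (Basis ι L q N),
      prep (EuclideanSpace.single (none, 0, Sum.inl (0, false)) 1) =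
        (((√N)⁻¹ : ℝ) : ℂ) • clock ι L q (fun _ : Fin N => false) := by
  have hN : (0 : ℝ) < N := Nat.cast_pos.2 (NeZero.pos N)
  have hi : inner ℂ (EuclideanSpace.single (none, 0, Sum.inl (0, false)) 1)
      ((((√N)⁻¹ : ℝ) : ℂ) • clock ι L q (fun _ : Fin N => false)) = (((√N)⁻¹ : ℝ) : ℂ) := by
    rw [EuclideanSpace.inner_single_left, WithLp.ofLp_smul, Pi.smul_apply, clock_apply,
      if_pos ⟨0, rfl⟩]
    simp
  refine exists_isometry_map ?_ ?_
  · have h : ‖clock ι L q (fun _ : Fin N => false)‖ = √N := by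
      rw [← norm_clock_sq (ι := ι) (L := L) (q := q) (fun _ : Fin N => false),
        Real.sqrt_sq (norm_nonneg _)]
    rw [norm_smul, h, PiLp.norm_single, norm_one, Complex.norm_real, Real.norm_of_nonneg (by positivity),
      inv_mul_cancel₀ (by positivity)]
  · rw [← inner_conj_symm _ (EuclideanSpace.single _ _), hi, Complex.conj_ofReal]

/-- A solution of the dual adversary constraints gives a quantum query algorithm. -/
theorem exists_algorithm_of_dual_adversary (P : Problem ι q) (hN : 0 < N) (J : L → ι)
    (u w : (ι → Fin q) → L → ℂ)
    (huw : ∀ x y, P.Yes x → ¬ P.Yes y → ∑ l, conj (u x l) * w y l = -1 / 2)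
    (h0 : ∀ x y, P.Yes x → ¬ P.Yes y →
      ∑ l, (if x (J l) = y (J l) then conj (u x l) * w y l else 0) = 0)
    (hu : ∀ x, 100 * ∑ l, ‖u x l‖ ^ 2 ≤ N) (hw : ∀ y, 100 * ∑ l, ‖w y l‖ ^ 2 ≤ N) :
    ∃ A : Algorithm ι q, A.Decides P ∧ A.queries = 2 * N := by
  have : NeZero N := ⟨hN.ne'⟩
  have hN' : (0 : ℝ) < N := Nat.cast_pos.2 hN
  obtain ⟨prep, hprep⟩ := exists_prep (ι := ι) (L := L) (q := q) (N := N)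
  set κ : ℝ := (√N)⁻¹ with hκ
  have hκ2 : κ ^ 2 * N = 1 := by
    rw [hκ, inv_pow, Real.sq_sqrt hN'.le, inv_mul_cancel₀ hN'.ne']
  refine ⟨roundsAlgorithm J P.Yes (fun y => ¬ P.Yes y) u w prep, ?_, rfl⟩
  set A := flagged ι L q N with hA
  -- There is no time `N`, so the reflection that follows the last query is the identity.
  have hlast : startVectors N J P.Yes u N = ∅ := by
    ext z
    simp [startVectors]
  set φ : (ι → Fin q) → EuclideanSpace ℂ (Basis ι L q N) := fun x =>
    rounds J P.Yes (fun y => ¬ P.Yes y) u w x ((κ : ℂ) • clock ι L q (fun _ : Fin N => false)) N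
    with hφ
  have hprob : ∀ x, (roundsAlgorithm J P.Yes (fun y => ¬ P.Yes y) u w prep).acceptProb x =
      ‖restrict A (φ x)‖ ^ 2 := by
    intro x
    have hs := roundsAlgorithm_state J P.Yes (fun y => ¬ P.Yes y) u w prep x N
    rw [hlast, flip_of_orthogonal (by simp), hprep] at hs
    rw [norm_restrict_sq]
    exact Finset.sum_congr rfl fun a _ => congrArg (fun z : ℂ => ‖z‖ ^ 2) (congrFun hs a)
  have hmem : ∀ a : Basis ι L q N, a ∈ A ↔ ∃ j, a.2.2 = Sum.inl (j, true) := fun a => by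
    rw [hA]
    simp [flagged]
  -- The squared distance is at most `κ ^ 2 * N / 100 = (1 / 10) ^ 2`.
  have hsmall : ∀ f : L → ℂ, 100 * ∑ l, ‖f l‖ ^ 2 ≤ N → ∀ b : Fin N → Bool,
      ‖(κ : ℂ) • clock ι L q b - (κ : ℂ) • (clock ι L q b + labelled N J 0 f)‖ ≤ 1 / 10 := by
    intro f hf b
    rw [← smul_sub, sub_add_cancel_left, norm_smul, norm_neg, Complex.norm_real]
    refine le_of_sq_le_sq ?_ (by norm_num)
    rw [mul_pow, norm_labelled_sq, Real.norm_eq_abs, sq_abs]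
    nlinarith [sq_nonneg κ]
  intro x _
  rw [hprob]
  have hφ0 : 0 ≤ ‖restrict A (φ x)‖ := norm_nonneg _
  constructor
  · intro hx
    have hd := norm_rounds_sub J P.Yes (fun y => ¬ P.Yes y) u w x
      ((κ : ℂ) • clock ι L q (fun _ : Fin N => false)) κ
      (fun t => clock ι L q (fun j : Fin N => decide ((j : ℕ) < t)) +
          (-1 : ℂ) ^ t • labelled N J 0 (u x))
      (fun t ht => round_yes h0 hx ht) N le_rfl
    have hs := hsmall (u x) (hu x) (fun _ => false)
    simp only [Nat.not_lt_zero, decide_false, pow_zero, one_smul] at hd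
    rw [← hd] at hs
    have hr : restrict A ((κ : ℂ) • (clock ι L q (fun j : Fin N => decide ((j : ℕ) < N)) +
          (-1 : ℂ) ^ N • labelled N J 0 (u x))) = (κ : ℂ) • clock ι L q (fun _ : Fin N => true) := by
      ext ⟨i, c, a⟩
      simp only [restrict, hmem, WithLp.ofLp_smul, WithLp.ofLp_add, Pi.smul_apply, Pi.add_apply,
        clock_apply, Fin.is_lt, decide_true]
      split_ifs with h h' h'
      · obtain ⟨j, rfl⟩ := h
        rw [labelled_apply_inl]
        simp
      · obtain ⟨j, rfl⟩ := h
        rw [labelled_apply_inl]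
        simp
      · obtain ⟨j, h'⟩ := h'
        exact absurd ⟨j, (Prod.ext_iff.1 (Prod.ext_iff.1 h').2).2⟩ h
      · simp
    have h1 : ‖(κ : ℂ) • clock ι L q (fun _ : Fin N => true)‖ = 1 := by
      refine (sq_eq_sq₀ (norm_nonneg _) zero_le_one).1 ?_
      rw [norm_smul, mul_pow, norm_clock_sq, Complex.norm_real, Real.norm_eq_abs, sq_abs, hκ2,
        one_pow]
    have h2 := (norm_restrict_sub_le A _ _).trans hs
    rw [hr] at h2
    have h3 := norm_sub_norm_le ((κ : ℂ) • clock ι L q (fun _ : Fin N => true)) (restrict A (φ x))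
    rw [norm_sub_rev, h1] at h3
    -- The accepted part has norm at least `9 / 10`, and `(9 / 10) ^ 2 ≥ 2 / 3`.
    nlinarith [h3.trans h2]
  · intro hx
    have hd := norm_rounds_sub J P.Yes (fun y => ¬ P.Yes y) u w x
      ((κ : ℂ) • clock ι L q (fun _ : Fin N => false)) κ
      (fun t => clock ι L q (fun _ : Fin N => false) + (-1 : ℂ) ^ t • labelled N J 0 (w x))
      (fun t _ => round_no huw hx t) N le_rfl
    have hs := hsmall (w x) (hw x) (fun _ => false)
    simp only [pow_zero, one_smul] at hd
    rw [← hd] at hs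
    have hr : restrict A ((κ : ℂ) • (clock ι L q (fun _ : Fin N => false) +
          (-1 : ℂ) ^ N • labelled N J 0 (w x))) = 0 := by
      ext ⟨i, c, a⟩
      simp only [restrict, hmem, WithLp.ofLp_smul, WithLp.ofLp_add, Pi.smul_apply, Pi.add_apply,
        clock_apply]
      split_ifs with h h'
      · obtain ⟨j, rfl⟩ := h
        obtain ⟨k, h'⟩ := h'
        simp at h'
      · obtain ⟨j, rfl⟩ := h
        rw [labelled_apply_inl]
        simp
      · rfl
    have h2 := (norm_restrict_sub_le A _ _).trans hs
    rw [hr, sub_zero] at h2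
    nlinarith [h2]

end AdversaryAlgorithm

/-! ### Classical algorithms with few wrong guesses -/

section GuessingTree

open scoped ComplexConjugate

variable {ι R : Type} {q : ℕ}

/-- The transcript of the classical adaptive algorithm that asks for `J l` when its transcript so
far is `l`, and extends it by the digest of the letter: `none` if a guess was right. -/
def transcript (J : List (Option R) → ι) (digest : List (Option R) → Fin q → Option R)
    (x : ι → Fin q) : ℕ → List (Option R)
  | 0 => []
  | t + 1 => digest (transcript J digest x t) (x (J (transcript J digest x t))) ::
      transcript J digest x t

/-- The digest obtained at time `t`. -/
def digestAt (J : List (Option R) → ι) (digest : List (Option R) → Fin q → Option R)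
    (x : ι → Fin q) (t : ℕ) : Option R :=
  digest (transcript J digest x t) (x (J (transcript J digest x t)))

lemma transcript_succ (J : List (Option R) → ι) (digest : List (Option R) → Fin q → Option R)
    (x : ι → Fin q) (t : ℕ) : transcript J digest x (t + 1) =
      digestAt J digest x t :: transcript J digest x t := rfl

variable [DecidableEq R]

/-- A transcript contains its past, so two transcripts that differ never agree again: there is at
most one divergence to count. -/
lemma sum_divergences (J : List (Option R) → ι) (digest : List (Option R) → Fin q → Option R)
    (x y : ι → Fin q) (T : ℕ) :
    (∑ t ∈ Finset.range T, if transcript J digest x t = transcript J digest y t then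
      (if digestAt J digest x t = digestAt J digest y t then (0 : ℂ) else 1) else 0) =
      if transcript J digest x T = transcript J digest y T then 0 else 1 := by
  induction T with
  | zero => simp [transcript]
  | succ T ih =>
    rw [Finset.sum_range_succ, ih, transcript_succ, transcript_succ]
    simp only [List.cons.injEq]
    split_ifs <;> simp_all

omit [DecidableEq R] in
lemma sum_isSome_digestAt (J : List (Option R) → ι) (digest : List (Option R) → Fin q → Option R)
    (x : ι → Fin q) (T : ℕ) :
    (∑ t ∈ Finset.range T, if (digestAt J digest x t).isSome then 1 else 0) =
      (transcript J digest x T).countP Option.isSome := by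
  induction T with
  | zero => simp [transcript]
  | succ T ih => rw [Finset.sum_range_succ, ih, transcript_succ, List.countP_cons]

/-- The vectors that encode the digests on positive inputs. -/
noncomputable def posVec (ρ : ℝ) : Option R → Bool ⊕ Option R → ℂ
  | none, Sum.inl false => √ρ⁻¹
  | none, _ => 0
  | some _, Sum.inl true => √ρ
  | some _, Sum.inl false => 0
  | some _, Sum.inr none => 1
  | some r, Sum.inr (some s) => if r = s then 1 else 0

/-- The vectors that encode the digests on negative inputs. -/
noncomputable def negVec (ρ : ℝ) : Option R → Bool ⊕ Option R → ℂ
  | none, Sum.inl true => √ρ⁻¹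
  | none, _ => 0
  | some _, Sum.inl false => √ρ
  | some _, Sum.inl true => 0
  | some _, Sum.inr none => 1
  | some r, Sum.inr (some s) => if r = s then -1 else 0

/-- The weight of a digest. -/
noncomputable def digestWeight (ρ : ℝ) (c : Option R) : ℝ :=
  ρ⁻¹ + (ρ + 2) * (if c.isSome then (1 : ℕ) else 0 : ℕ)

variable [Fintype R]

/-- A right guess meets a wrong one with `√ρ⁻¹ * √ρ = 1`; two wrong guesses give `1` from the common
coordinate, minus `1` if they agree. -/
lemma sum_posVec_mul_negVec {ρ : ℝ} (hρ : 0 < ρ) (c d : Option R) :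
    ∑ v, conj (posVec ρ c v) * negVec ρ d v = if c = d then 0 else 1 := by
  have h : ((√ρ⁻¹ : ℝ) : ℂ) * (√ρ : ℝ) = 1 := by
    rw [← Complex.ofReal_mul, Real.sqrt_inv, inv_mul_cancel₀ (Real.sqrt_pos.2 hρ).ne',
      Complex.ofReal_one]
  have h' : ((√ρ : ℝ) : ℂ) * (√ρ⁻¹ : ℝ) = 1 := by rw [mul_comm, h]
  rw [Fintype.sum_sum_type, Fintype.sum_option, Fintype.sum_bool]
  cases c with
  | none => cases d <;> simp [posVec, negVec, h, -Real.sqrt_inv]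
  | some r =>
    cases d with
    | none => simp [posVec, negVec, h', -Real.sqrt_inv]
    | some s =>
      by_cases hrs : r = s
      · subst hrs
        simp [posVec, negVec, apply_ite conj]
      · simp [posVec, negVec, hrs, apply_ite conj]

lemma sum_norm_posVec_sq_le {ρ : ℝ} (hρ : 0 < ρ) (c : Option R) :
    ∑ v, ‖posVec ρ c v‖ ^ 2 ≤ digestWeight ρ c := by
  rw [Fintype.sum_sum_type, Fintype.sum_option, Fintype.sum_bool, digestWeight]
  have h : 0 ≤ ρ⁻¹ := (inv_pos.2 hρ).le
  cases c with
  | none => simp [posVec, -Real.sqrt_inv, Real.sq_sqrt h]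
  | some r =>
    have : ∀ s, ‖(if r = s then (1 : ℂ) else 0)‖ ^ 2 = if r = s then 1 else 0 := fun s => by
      split_ifs <;> simp
    simp [posVec, Real.sq_sqrt hρ.le, this]
    linarith

lemma sum_norm_negVec_sq_le {ρ : ℝ} (hρ : 0 < ρ) (c : Option R) :
    ∑ v, ‖negVec ρ c v‖ ^ 2 ≤ digestWeight ρ c := by
  rw [Fintype.sum_sum_type, Fintype.sum_option, Fintype.sum_bool, digestWeight]
  have h : 0 ≤ ρ⁻¹ := (inv_pos.2 hρ).le
  cases c with
  | none => simp [negVec, -Real.sqrt_inv, Real.sq_sqrt h]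
  | some r =>
    have : ∀ s, ‖(if r = s then (-1 : ℂ) else 0)‖ ^ 2 = if r = s then 1 else 0 := fun s => by
      split_ifs <;> simp
    simp [negVec, Real.sq_sqrt hρ.le, this]
    linarith

variable {T : ℕ} {S : Finset (List (Option R))}

/-- The vector that carries the encoding `f` of the digests along the transcript of `x`. -/
def pathVec (J : List (Option R) → ι) (digest : List (Option R) → Fin q → Option R)
    (f : Option R → Bool ⊕ Option R → ℂ) (x : ι → Fin q) (l : (Fin T × S) × (Bool ⊕ Option R)) :
    ℂ :=
  if (l.1.2 : List (Option R)) = transcript J digest x l.1.1 then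
    f (digestAt J digest x l.1.1) l.2 else 0

omit [DecidableEq R] in
lemma sum_nodes {M : Type*} [AddCommMonoid M]
    (F : ℕ → List (Option R) → Bool ⊕ Option R → M) :
    ∑ l : (Fin T × S) × (Bool ⊕ Option R), F l.1.1 l.1.2 l.2 =
      ∑ t ∈ Finset.range T, ∑ h ∈ S, ∑ v, F t h v := by
  rw [Fintype.sum_prod_type, Fintype.sum_prod_type,
    ← Fin.sum_univ_eq_sum_range (fun t => ∑ h ∈ S, ∑ v, F t h v)]
  exact Finset.sum_congr rfl fun t _ => Finset.sum_coe_sort S fun h => ∑ v, F t h v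

/-- At each time only a node on both transcripts contributes. The filter `p` allows both adversary
constraints to be read off. -/
lemma sum_pathVec_mul (J : List (Option R) → ι) (digest : List (Option R) → Fin q → Option R)
    (f g : Option R → Bool ⊕ Option R → ℂ) (x y : ι → Fin q)
    (hS : ∀ t < T, transcript J digest x t ∈ S) (p : List (Option R) → Prop) [DecidablePred p] :
    ∑ l : (Fin T × S) × (Bool ⊕ Option R), (if p l.1.2 then
        conj (pathVec J digest f x l) * pathVec J digest g y l else 0) =
      ∑ t ∈ Finset.range T, if transcript J digest x t = transcript J digest y t then
        (if p (transcript J digest x t) then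
          ∑ v, conj (f (digestAt J digest x t) v) * g (digestAt J digest y t) v else 0) else 0 := by
  simp only [pathVec]
  rw [sum_nodes (fun t h v => if p h then
    conj (if h = transcript J digest x t then f (digestAt J digest x t) v else 0) *
      (if h = transcript J digest y t then g (digestAt J digest y t) v else 0) else 0)]
  refine Finset.sum_congr rfl fun t ht => ?_
  rw [Finset.sum_eq_single (transcript J digest x t)]
  · simp only [if_true]
    split_ifs <;> simp
  · intro h _ hh
    simp [hh]
  · intro h
    exact absurd (hS t (Finset.mem_range.1 ht)) h

lemma sum_norm_pathVec_sq (J : List (Option R) → ι)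
    (digest : List (Option R) → Fin q → Option R)
    (f : Option R → Bool ⊕ Option R → ℂ) (x : ι → Fin q)
    (hS : ∀ t < T, transcript J digest x t ∈ S) :
    ∑ l : (Fin T × S) × (Bool ⊕ Option R), ‖pathVec J digest f x l‖ ^ 2 =
      ∑ t ∈ Finset.range T, ∑ v, ‖f (digestAt J digest x t) v‖ ^ 2 := by
  simp only [pathVec]
  rw [sum_nodes (fun t h v =>
    ‖(if h = transcript J digest x t then f (digestAt J digest x t) v else 0)‖ ^ 2)]
  refine Finset.sum_congr rfl fun t ht => ?_
  rw [Finset.sum_eq_single (transcript J digest x t)]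
  · simp
  · intro h _ hh
    simp [hh]
  · intro h
    exact absurd (hS t (Finset.mem_range.1 ht)) h

omit [DecidableEq R] [Fintype R] in
lemma sum_digestWeight_le (J : List (Option R) → ι)
    (digest : List (Option R) → Fin q → Option R) {ρ : ℝ} (hρ : 0 < ρ) (x : ι → Fin q) {G : ℕ}
    (hG : (transcript J digest x T).countP Option.isSome ≤ G) :
    ∑ t ∈ Finset.range T, digestWeight ρ (digestAt J digest x t) ≤ T * ρ⁻¹ + G * (ρ + 2) := by
  simp only [digestWeight]
  rw [Finset.sum_add_distrib, ← Finset.mul_sum, ← Nat.cast_sum, sum_isSome_digestAt,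
    Finset.sum_const, Finset.card_range, nsmul_eq_mul, mul_comm (ρ + 2)]
  have : ((transcript J digest x T).countP Option.isSome : ℝ) ≤ G := by exact_mod_cast hG
  gcongr

/-- A classical algorithm that makes `T` queries and guesses wrong at most `G` times gives a quantum
algorithm whose number of queries is of the order of `T / ρ + G * ρ`, for any `ρ`. -/
theorem exists_algorithm_of_guessing [Fintype ι] [DecidableEq ι] [NeZero q] (P : Problem ι q)
    (J : List (Option R) → ι) (digest : List (Option R) → Fin q → Option R) (T G N : ℕ) {ρ : ℝ}
    (hρ : 0 < ρ) (hN : 0 < N) (hbound : 100 * (T * ρ⁻¹ + G * (ρ + 2)) ≤ N)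
    (hG : ∀ x, (transcript J digest x T).countP Option.isSome ≤ G)
    (hP : ∀ x y, P.Yes x → ¬ P.Yes y → transcript J digest x T ≠ transcript J digest y T) :
    ∃ A : Algorithm ι q, A.Decides P ∧ A.queries = 2 * N := by
  classical
  -- Labels must form a finite type, so only the transcripts that occur are kept.
  let S : Finset (List (Option R)) :=
    Finset.univ.image fun p : (ι → Fin q) × Fin T => transcript J digest p.1 p.2
  have hS : ∀ x, ∀ t < T, transcript J digest x t ∈ S := fun x t ht =>
    Finset.mem_image.2 ⟨(x, ⟨t, ht⟩), Finset.mem_univ _, rfl⟩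
  let u : (ι → Fin q) → (Fin T × S) × (Bool ⊕ Option R) → ℂ := pathVec J digest (posVec ρ)
  let w : (ι → Fin q) → (Fin T × S) × (Bool ⊕ Option R) → ℂ :=
    pathVec J digest fun c v => -1 / 2 * negVec ρ c v
  have hpair : ∀ c d : Option R, ∑ v, conj (posVec ρ c v) * (-1 / 2 * negVec ρ d v) =
      -1 / 2 * if c = d then 0 else 1 := fun c d => by
    rw [← sum_posVec_mul_negVec hρ, Finset.mul_sum]
    exact Finset.sum_congr rfl fun v _ => by ring
  refine exists_algorithm_of_dual_adversary P hN (fun l => J l.1.2) u w ?_ ?_ ?_ ?_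
  · intro x y hx hy
    have h := sum_pathVec_mul J digest (posVec ρ) (fun c v => -1 / 2 * negVec ρ c v) x y (hS x)
      (fun _ => True)
    simp only [if_true, hpair] at h
    refine h.trans ?_
    have h' := sum_divergences J digest x y T
    rw [if_neg (hP x y hx hy)] at h'
    have h'' := congrArg (fun z : ℂ => -1 / 2 * z) h'
    simp only [mul_one, Finset.mul_sum] at h''
    exact (Finset.sum_congr rfl fun t _ => by split_ifs <;> simp).trans h''
  · intro x y _ _
    refine (sum_pathVec_mul J digest (posVec ρ) (fun c v => -1 / 2 * negVec ρ c v) x y (hS x)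
      (fun l => x (J l) = y (J l))).trans (Finset.sum_eq_zero fun t _ => ?_)
    rw [hpair]
    split_ifs with h1 h2 h3 <;> try simp
    -- Equal letters after equal transcripts have equal digests, which pair to zero.
    exact absurd (by rw [digestAt, digestAt, ← h1, h2]) h3
  · intro x
    refine le_trans ?_ hbound
    refine mul_le_mul_of_nonneg_left ?_ (by norm_num)
    rw [sum_norm_pathVec_sq J digest _ x (hS x)]
    exact (Finset.sum_le_sum fun t _ => sum_norm_posVec_sq_le hρ _).trans
      (sum_digestWeight_le J digest hρ x (hG x))
  · intro x
    refine le_trans ?_ hbound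
    refine mul_le_mul_of_nonneg_left ?_ (by norm_num)
    rw [sum_norm_pathVec_sq J digest _ x (hS x)]
    refine (Finset.sum_le_sum fun t _ => ?_).trans (sum_digestWeight_le J digest hρ x (hG x))
    refine (Finset.sum_le_sum fun v _ => ?_).trans (sum_norm_negVec_sq_le hρ _)
    rw [norm_mul, mul_pow]
    norm_num
    nlinarith [sq_nonneg ‖negVec ρ (digestAt J digest x t) v‖]

end GuessingTree

/-! ### Graph search by guessing that nothing new is found -/

section GraphSearch

variable {V P : Type} {q : ℕ}

/-- The vertices that a search from `s` has discovered, if `l` is its transcript. -/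
def discovered (s : V) (l : List (Option V)) : Set V := {v | v = s ∨ some v ∈ l}

open Classical in
/-- A pair of a vertex of `D` and a port that is not in `Q`, and `a` if there is none. -/
noncomputable def unasked (a : V × P) (D : Set V) (Q : Set (V × P)) : V × P :=
  if h : ∃ b, b ∉ Q ∧ b.1 ∈ D then h.choose else a

/-- The pairs that the search has asked for. -/
noncomputable def asked (a : V × P) : List (Option V) → Set (V × P)
  | [] => ∅
  | _ :: l => insert (unasked a (discovered a.1 l) (asked a l)) (asked a l)

/-- The pair that the search from `a.1` asks for next. -/
noncomputable def ask (a : V × P) (l : List (Option V)) : V × P :=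
  unasked a (discovered a.1 l) (asked a l)

open Classical in
/-- What the search learns from a letter: a new vertex, or nothing. -/
noncomputable def newVertex (nb : V × P → Fin q → Option V) (a : V × P) (l : List (Option V))
    (c : Fin q) : Option V :=
  (nb (ask a l) c).filter fun v => v ∉ discovered a.1 l

/-- The edges of the graph given by the input `x`. -/
def portEdge (nb : V × P → Fin q → Option V) (x : V × P → Fin q) (u v : V) : Prop :=
  ∃ p, nb (u, p) (x (u, p)) = some v

lemma ask_fst_mem (a : V × P) (l : List (Option V)) : (ask a l).1 ∈ discovered a.1 l := by
  rw [ask, unasked]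
  split_ifs with h
  · exact h.choose_spec.2
  · exact Or.inl rfl

lemma newVertex_eq_some {nb : V × P → Fin q → Option V} {a : V × P} {l : List (Option V)}
    {c : Fin q} {v : V} :
    newVertex nb a l c = some v ↔ nb (ask a l) c = some v ∧ v ∉ discovered a.1 l := by
  simp [newVertex, Option.filter_eq_some_iff]

lemma mem_discovered_cons {s v : V} {c : Option V} {l : List (Option V)} :
    v ∈ discovered s (c :: l) ↔ c = some v ∨ v ∈ discovered s l := by
  simp only [discovered, Set.mem_ofPred_eq, List.mem_cons, eq_comm (a := some v) (b := c)]
  tauto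

variable (nb : V × P → Fin q → Option V) (a : V × P) (x : V × P → Fin q)

/-- The transcript of the search from `a.1`. -/
noncomputable def searchTranscript (t : ℕ) : List (Option V) :=
  transcript (ask a) (newVertex nb a) x t

lemma searchTranscript_succ (t : ℕ) : searchTranscript nb a x (t + 1) =
    newVertex nb a (searchTranscript nb a x t) (x (ask a (searchTranscript nb a x t))) ::
      searchTranscript nb a x t := rfl

lemma reachable_of_mem_discovered (t : ℕ) {v : V}
    (hv : v ∈ discovered a.1 (searchTranscript nb a x t)) :
    Relation.ReflTransGen (portEdge nb x) a.1 v := by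
  induction t generalizing v with
  | zero =>
    rcases hv with rfl | hv
    · exact .refl
    · simp [searchTranscript, transcript] at hv
  | succ t ih =>
    rw [searchTranscript_succ, mem_discovered_cons, newVertex_eq_some] at hv
    rcases hv with ⟨hv, _⟩ | hv
    · exact (ih (ask_fst_mem a _)).tail ⟨_, hv⟩
    · exact ih hv

lemma mem_discovered_of_asked (t : ℕ) {b : V × P} {v : V}
    (hb : b ∈ asked a (searchTranscript nb a x t)) (hv : nb b (x b) = some v) :
    v ∈ discovered a.1 (searchTranscript nb a x t) := by
  induction t with
  | zero => exact absurd hb (Set.notMem_empty b)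
  | succ t ih =>
    rw [searchTranscript_succ, mem_discovered_cons, newVertex_eq_some]
    rcases hb with rfl | hb
    · by_cases h : v ∈ discovered a.1 (searchTranscript nb a x t)
      · exact Or.inr h
      · exact Or.inl ⟨hv, h⟩
    · exact Or.inr (ih hb)

lemma nodup_searchTranscript (t : ℕ) : ((searchTranscript nb a x t).filterMap id).Nodup := by
  induction t with
  | zero => exact List.nodup_nil
  | succ t ih =>
    rw [searchTranscript_succ]
    cases h : newVertex nb a (searchTranscript nb a x t)
      (x (ask a (searchTranscript nb a x t))) with
    | none => simpa using ih
    | some v =>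
      rw [List.filterMap_cons_some (by rfl), List.nodup_cons]
      refine ⟨fun hv => (newVertex_eq_some.1 h).2 (Or.inr ?_), ih⟩
      simpa using hv

lemma countP_searchTranscript_le [Fintype V] (t : ℕ) :
    (searchTranscript nb a x t).countP Option.isSome ≤ Fintype.card V := by
  have h := (nodup_searchTranscript nb a x t).length_le_card
  rwa [List.length_filterMap_eq_countP] at h

/-- Each step asks a fresh pair until the discovered vertices have none left. From then on the
default `a` is asked again; it was asked before, so it reveals nothing. -/
lemma ncard_asked [Finite V] [Finite P] (t : ℕ) :
    (asked a (searchTranscript nb a x t)).ncard = t ∨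
      ∀ b : V × P, b.1 ∈ discovered a.1 (searchTranscript nb a x t) →
        b ∈ asked a (searchTranscript nb a x t) := by
  induction t with
  | zero => exact Or.inl (Set.ncard_empty _)
  | succ t ih =>
    by_cases h : ∃ b : V × P, b ∉ asked a (searchTranscript nb a x t) ∧
        b.1 ∈ discovered a.1 (searchTranscript nb a x t)
    · left
      rcases ih with ih | ih
      · have h' : ask a (searchTranscript nb a x t) ∉ asked a (searchTranscript nb a x t) := by
          rw [ask, unasked, dif_pos h]
          exact h.choose_spec.1
        rw [searchTranscript_succ, asked, ← ask, Set.ncard_insert_of_notMem h', ih]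
      · obtain ⟨b, hb, hb'⟩ := h
        exact absurd (ih b hb') hb
    · right
      have ha : ask a (searchTranscript nb a x t) = a := by rw [ask, unasked, dif_neg h]
      push Not at h
      have h' : ∀ b : V × P, b.1 ∈ discovered a.1 (searchTranscript nb a x t) →
          b ∈ asked a (searchTranscript nb a x t) := fun b hb => by
        by_contra hb'
        exact h b hb' hb
      intro b hb
      refine Set.mem_insert_of_mem _ (h' b ?_)
      rw [searchTranscript_succ, mem_discovered_cons, newVertex_eq_some, ha] at hb
      rcases hb with ⟨hb, _⟩ | hb
      · exact mem_discovered_of_asked nb a x t (h' a (Or.inl rfl)) hb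
      · exact hb

/-- After as many steps as there are pairs, both alternatives of `ncard_asked` leave no unasked pair
at a discovered vertex, so the discovered set is closed under edges. -/
lemma mem_discovered_iff [Finite V] [Finite P] (v : V) :
    v ∈ discovered a.1 (searchTranscript nb a x (Nat.card (V × P))) ↔
      Relation.ReflTransGen (portEdge nb x) a.1 v := by
  refine ⟨reachable_of_mem_discovered nb a x _, fun h => ?_⟩
  have hall : ∀ b : V × P,
      b.1 ∈ discovered a.1 (searchTranscript nb a x (Nat.card (V × P))) →
        b ∈ asked a (searchTranscript nb a x (Nat.card (V × P))) := by
    rcases ncard_asked nb a x (Nat.card (V × P)) with h | h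
    · rw [← Set.ncard_univ] at h
      have := Set.eq_of_subset_of_ncard_le (Set.subset_univ _) h.ge
      intro b _
      rw [← Set.ncard_univ] at *
      rw [this]
      trivial
    · exact h
  induction h with
  | refl => exact Or.inl rfl
  | tail _ h ih =>
    obtain ⟨p, hp⟩ := h
    exact mem_discovered_of_asked nb a x _ (hall _ ih) hp

/-- Reachability of all vertices of a graph with `n` vertices and `k` ports at each vertex takes
`O(n * √k)` quantum queries. -/
theorem exists_algorithm_of_search [Fintype V] [DecidableEq V] [Fintype P] [DecidableEq P]
    [NeZero q] (Q : Problem (V × P) q)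
    (hQ : ∀ x, Q.Valid x → (Q.Yes x ↔ ∀ v, Relation.ReflTransGen (portEdge nb x) a.1 v)) :
    ∃ A : Algorithm (V × P) q, A.Decides Q ∧
      (A.queries : ℝ) ≤ 802 * (Fintype.card V * √(Fintype.card P)) := by
  set n := Fintype.card V
  set k := Fintype.card P
  have hn : (1 : ℝ) ≤ n := by exact_mod_cast Fintype.card_pos_iff.2 ⟨a.1⟩
  have hk : (1 : ℝ) ≤ k := by exact_mod_cast Fintype.card_pos_iff.2 ⟨a.2⟩
  have hk' : 1 ≤ √(k : ℝ) := Real.one_le_sqrt.2 hk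
  -- The adversary constraints compare all inputs, valid or not, so the answer is replaced by one
  -- that is reachability everywhere.
  let Q' : Problem (V × P) q :=
    ⟨Q.Valid, fun x => ∀ v, Relation.ReflTransGen (portEdge nb x) a.1 v⟩
  -- With `m = n * √k` the bound needed is `100 * (m + m + 2 * n)`, at most `400 * m` as `√k ≥ 1`.
  obtain ⟨A, hA, hq⟩ := exists_algorithm_of_guessing Q' (ask a) (newVertex nb a)
    (Nat.card (V × P)) n ⌈400 * (n * √(k : ℝ))⌉₊ (ρ := √(k : ℝ)) (by linarith)
    (Nat.ceil_pos.2 (by positivity))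
    (by
      refine le_trans ?_ (Nat.le_ceil _)
      have hT : (Nat.card (V × P) : ℝ) * (√(k : ℝ))⁻¹ = n * √(k : ℝ) := by
        rw [Nat.card_eq_fintype_card, Fintype.card_prod, Nat.cast_mul, mul_assoc,
          ← div_eq_mul_inv, Real.div_sqrt]
      rw [hT]
      nlinarith)
    (fun x => countP_searchTranscript_le nb a x _)
    (fun x y hx hy h => hy fun v => by
      have hv := (mem_discovered_iff nb a x v).2 (hx v)
      rw [searchTranscript, h] at hv
      exact (mem_discovered_iff nb a y v).1 hv)
  refine ⟨A, fun x hx => ?_, ?_⟩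
  · rw [hQ x hx]
    exact hA x hx
  · have := Nat.ceil_lt_add_one (a := 400 * (n * √(k : ℝ))) (by positivity)
    rw [hq]
    push_cast
    nlinarith

end GraphSearch

/-! ### Bounding the complexity by one algorithm -/

section Complexity

variable {ι : Type} [Fintype ι] [DecidableEq ι] {q : ℕ}

lemma exists_complexity_eq {P : Problem ι q} {B : ℝ}
    (h : ∃ A : Algorithm ι q, A.Decides P ∧ (A.queries : ℝ) ≤ B) :
    ∃ T : ℕ, complexity P = (T : ℕ∞) ∧ (T : ℝ) ≤ B := by
  obtain ⟨A, hA, hB⟩ := h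
  have hle : complexity P ≤ (A.queries : ℕ∞) := iInf₂_le A hA
  obtain ⟨T, hT⟩ := ENat.ne_top_iff_exists.1 (ne_top_of_le_ne_top (ENat.natCast_ne_top _) hle)
  refine ⟨T, hT.symm, le_trans ?_ hB⟩
  rw [← hT] at hle
  exact_mod_cast hle

/-- A problem whose answer is the same on all valid inputs needs no query. -/
lemma exists_algorithm_of_constant [NeZero q] (P : Problem ι q) (b : Prop)
    (h : ∀ x, P.Valid x → (P.Yes x ↔ b)) :
    ∃ A : Algorithm ι q, A.Decides P ∧ A.queries = 0 := by
  classical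
  let A : Algorithm ι q :=
    { W := Unit
      start := (none, 0, ())
      queries := 0
      U := fun _ => 1
      accept := if b then {(none, 0, ())} else ∅ }
  refine ⟨A, fun x hx => ?_, rfl⟩
  rw [h x hx]
  have hs : A.state x A.queries = Pi.single (none, 0, ()) 1 := by
    exact Matrix.one_mulVec _
  rw [Algorithm.acceptProb, hs]
  by_cases hb : b
  · have : A.accept = {(none, 0, ())} := if_pos hb
    rw [this, Finset.sum_singleton]
    simp [hb]
    norm_num
  · have : A.accept = ∅ := if_neg hb
    rw [this, Finset.sum_empty]
    simp [hb]

end Complexity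

/-! ### The two graph models -/

section Graphs

lemma connected_fromRel_iff {V : Type*} {r : V → V → Prop} (hr : ∀ u v, r u v → r v u) (s : V) :
    (SimpleGraph.fromRel r).Connected ↔ ∀ v, Relation.ReflTransGen r s v := by
  have hiff : ∀ v, (SimpleGraph.fromRel r).Reachable s v ↔ Relation.ReflTransGen r s v := by
    intro v
    rw [SimpleGraph.reachable_iff_reflTransGen]
    constructor
    · refine fun h => Relation.ReflTransGen.mono (fun u v h => ?_) s v h
      rw [SimpleGraph.fromRel_adj] at h
      exact h.2.elim id (hr v u)
    · intro h
      induction h with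
      | refl => exact .refl
      | @tail u v _ h ih =>
        by_cases huv : u = v
        · exact huv ▸ ih
        · exact ih.tail ((SimpleGraph.fromRel_adj r u v).2 ⟨huv, Or.inl h⟩)
  constructor
  · exact fun h v => (hiff v).1 (h.preconnected s v)
  · intro h
    have : Nonempty V := ⟨s⟩
    exact ⟨fun u v => ((hiff u).2 (h u)).symm.trans ((hiff v).2 (h v))⟩

/-- The neighbour at a port in the matrix model: the ports are the vertices. -/
def matrixNeighbor {n : ℕ} (a : Fin n × Fin n) (c : Fin 2) : Option (Fin n) :=
  if c = 1 then some a.2 else none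

lemma portEdge_matrixNeighbor {n : ℕ} (M : Fin n × Fin n → Fin 2) :
    portEdge matrixNeighbor M = matrixEdge M := by
  ext u v
  simp [portEdge, matrixNeighbor, matrixEdge]

lemma portEdge_some {n k : ℕ} (f : Fin n × Fin k → Fin n) :
    portEdge (fun _ => some) f = listEdge f := by
  ext u v
  simp [portEdge, listEdge]

/-- The constant doubles because `log n ≥ log 2 > 1 / 2`. -/
lemma le_mul_log {n : ℕ} (hn : 2 ≤ n) {X B : ℝ} (hB : 0 ≤ B) (h : X ≤ 802 * B) :
    X ≤ 1604 * (B * Real.log n) := by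
  have h2 : Real.log 2 ≤ Real.log n := Real.log_le_log two_pos (by exact_mod_cast hn)
  have := Real.log_two_gt_d9
  nlinarith [mul_le_mul_of_nonneg_left (show (1 / 2 : ℝ) ≤ Real.log n by linarith) hB]

lemma matrix_complexity_le {n : ℕ} (s : Fin n) (Q : Problem (Fin n × Fin n) 2)
    (hQ : ∀ M, Q.Valid M → (Q.Yes M ↔ ∀ v, Relation.ReflTransGen (matrixEdge M) s v)) :
    ∃ T : ℕ, complexity Q = (T : ℕ∞) ∧
      (T : ℝ) ≤ 1604 * ((n : ℝ) ^ (3 / 2 : ℝ) * Real.log n) := by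
  apply exists_complexity_eq
  have hn : 0 < n := s.pos
  by_cases h1 : n = 1
  · subst h1
    obtain ⟨A, hA, hq⟩ := exists_algorithm_of_constant Q True fun M hM => by
      rw [hQ M hM, iff_true]
      intro v
      rw [Subsingleton.elim s v]
    exact ⟨A, hA, by simp [hq]⟩
  · obtain ⟨A, hA, hq⟩ := exists_algorithm_of_search matrixNeighbor (s, s) Q fun M hM => by
      rw [hQ M hM, portEdge_matrixNeighbor]
    refine ⟨A, hA, le_mul_log (by omega) (by positivity) (hq.trans_eq ?_)⟩
    rw [Fintype.card_fin, show (3 / 2 : ℝ) = 1 + 1 / 2 by norm_num,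
      Real.rpow_add (by exact_mod_cast hn), Real.rpow_one, Real.sqrt_eq_rpow]

lemma list_complexity_le {n k : ℕ} (s : Fin n) (Q : Problem (Fin n × Fin k) n)
    (hQ : ∀ f, Q.Valid f → (Q.Yes f ↔ ∀ v, Relation.ReflTransGen (listEdge f) s v)) :
    ∃ T : ℕ, complexity Q = (T : ℕ∞) ∧
      (T : ℝ) ≤ 1604 * ((n : ℝ) * Real.sqrt k * Real.log n) := by
  apply exists_complexity_eq
  have hn : 0 < n := s.pos
  have : NeZero n := ⟨hn.ne'⟩
  by_cases h1 : n = 1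
  · obtain ⟨A, hA, hq⟩ := exists_algorithm_of_constant Q True fun M hM => by
      rw [hQ M hM, iff_true]
      intro v
      subst h1
      rw [Subsingleton.elim s v]
    exact ⟨A, hA, by simp [hq, h1]⟩
  -- Without ports the bound is zero and the search has no default pair, but the graph is then
  -- known.
  rcases Nat.eq_zero_or_pos k with rfl | hk
  · obtain ⟨A, hA, hq⟩ := exists_algorithm_of_constant Q
      (∀ v, Relation.ReflTransGen (fun _ _ => False) s v) fun f hf => by
        rw [hQ f hf]
        have : listEdge f = fun _ _ => False := by
          ext u v
          exact ⟨fun ⟨i, _⟩ => i.elim0, False.elim⟩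
        rw [this]
    exact ⟨A, hA, by simp [hq]⟩
  · obtain ⟨A, hA, hq⟩ := exists_algorithm_of_search (fun _ => some) (s, ⟨0, hk⟩) Q
      fun f hf => by rw [hQ f hf, portEdge_some]
    refine ⟨A, hA, le_mul_log (by omega) (by positivity) (hq.trans_eq ?_)⟩
    rw [Fintype.card_fin, Fintype.card_fin]

end Graphs

end QuantumQuery

theorem mainTheorem1 :
    (∃ C : ℝ, ∀ n : ℕ, 1 ≤ n →
      (∃ T : ℕ, QuantumQuery.complexity (QuantumQuery.matrixConnectivity n) = (T : ℕ∞) ∧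
        (T : ℝ) ≤ C * ((n : ℝ) ^ (3 / 2 : ℝ) * Real.log n)) ∧
      ∀ s : Fin n,
        ∃ T : ℕ, QuantumQuery.complexity (QuantumQuery.matrixReachability n s) = (T : ℕ∞) ∧
          (T : ℝ) ≤ C * ((n : ℝ) ^ (3 / 2 : ℝ) * Real.log n)) ∧
    (∃ C : ℝ, ∀ n k : ℕ, 1 ≤ n →
      (∃ T : ℕ, QuantumQuery.complexity (QuantumQuery.listConnectivity n k) = (T : ℕ∞) ∧
        (T : ℝ) ≤ C * ((n : ℝ) * Real.sqrt k * Real.log n)) ∧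
      ∀ s : Fin n,
        ∃ T : ℕ, QuantumQuery.complexity (QuantumQuery.listReachability n k s) = (T : ℕ∞) ∧
          (T : ℝ) ≤ C * ((n : ℝ) * Real.sqrt k * Real.log n)) := by
  refine ⟨⟨1604, fun n hn => ⟨?_, fun s => ?_⟩⟩, ⟨1604, fun n k hn => ⟨?_, fun s => ?_⟩⟩⟩
  · exact QuantumQuery.matrix_complexity_le ⟨0, hn⟩ _ fun M hM =>
      QuantumQuery.connected_fromRel_iff (fun u v h => (hM v u).trans h) _
  · exact QuantumQuery.matrix_complexity_le s _ fun M _ => Iff.rfl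
  · exact QuantumQuery.list_complexity_le ⟨0, hn⟩ _ fun f hf =>
      QuantumQuery.connected_fromRel_iff hf.2 _
  · exact QuantumQuery.list_complexity_le s _ fun f _ => Iff.rfl
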